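/- Let $(M,g)$ be a smooth $d$-dimensional Riemannian manifold (without boundary), and let $C$ be a smooth $(1,1)$-tensor field on $M$ which at every point $x$ is a symmetric positive definite endomorphism of $T_xM$ with respect to $g$. Let $C^{-1/2}$ denote the symmetric positive definite square root of $C^{-1}$. Then $$\hat g(u,v)=g(C^{-1/2}u,\,C^{-1/2}v)$$ is a smooth Riemannian metric on $M$, and the function $\rho=\sqrt{|C|}=\sqrt{\det C}$ equals $\sqrt{|g|/|\hat g|}$, where $|g|$ and $|\hat g|$ are the determinants of the two metrics in any common basis of the tangent space. Moreover there is a smooth vector field $\kappa$ on $M$, depending only on $g$ and $C$, such that for every smooth function $f:M\to\mathbb{R}$ $$\sum_{i,j} C_{ij}\nabla_i\nabla_j f=\Delta_{\hat g}f+\kappa\cdot\nabla f \qquad\text{and}\qquad \sum_{i,j}\nabla_j\nabla_i (C_{ij}f)=\rho^{-1}\Delta_{\hat g}(\rho f)-\operatorname{div}(\kappa f).$$ Here $\Delta_{\hat g}$ is the (negative semidefinite) Laplacian $\operatorname{div}\circ\nabla$ of the metric $\hat g$, and all other operators and inner products are those of $g$: $\nabla_i\nabla_j f$ is the Hessian for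 the Levi-Civita connection of $g$, the components $C_{ij}=g(e_i,Ce_j)$ are taken in a $g$-orthonormal basis $(e_i)$ of the tangent space, and $\sum_{i,j}\nabla_j\nabla_i(C_{ij}f)$ is the double divergence of the tensor $fC$, i.e. the divergence of the vector field with components $\sum_i\nabla_i (C_{ij}f)$. -/

import Mathlib

open Bundle Manifold Module
open scoped ContDiff

noncomputable section

namespace RiemannianOps

section LinearAlgebra

variable {V : Type*} [AddCommGroup V] [Module ℝ V] [FiniteDimensional ℝ V]

/-- The inverse square root `A ^ (-1/2)` of a diagonalizable endomorphism with positive eigenvalues,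
by the functional calculus: it is `p(A)`, where `p` is the polynomial interpolating
`t ↦ t ^ (-1/2)` at the eigenvalues of `A`. See `invSqrt_spec`. -/
def invSqrt (A : End ℝ V) : End ℝ V :=
  Polynomial.aeval A
    (Lagrange.interpolate A.charpoly.roots.toFinset id (fun t : ℝ => (Real.sqrt t)⁻¹))

theorem invSqrt_apply_eigenvector (A : End ℝ V) {v : V} {t : ℝ} (hv : v ≠ 0) (h : A v = t • v) :
    invSqrt A v = (Real.sqrt t)⁻¹ • v := by
  have hev : A.HasEigenvector t v :=
    ⟨Module.End.mem_eigenspace_iff.2 h, hv⟩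
  have hroot : t ∈ A.charpoly.roots.toFinset := by
    rw [Multiset.mem_toFinset, Polynomial.mem_roots A.charpoly_monic.ne_zero]
    exact (Module.End.hasEigenvalue_iff_isRoot_charpoly A t).1
      (Module.End.hasEigenvalue_of_hasEigenvector hev)
  have h1 := Module.End.aeval_apply_of_hasEigenvector (f := A)
    (p := Lagrange.interpolate A.charpoly.roots.toFinset id (fun t : ℝ => (Real.sqrt t)⁻¹)) hev
  have h2 := Lagrange.eval_interpolate_at_node (fun t : ℝ => (Real.sqrt t)⁻¹)
    (s := A.charpoly.roots.toFinset) (v := id) (Set.injOn_id _) hroot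
  rw [id] at h2
  rw [invSqrt, h1, h2]

/-- If `A` is symmetric and positive definite for an inner product `B`, then `invSqrt A` is the
symmetric positive definite endomorphism whose square is the inverse of `A`. -/
theorem invSqrt_spec (B : V →ₗ[ℝ] V →ₗ[ℝ] ℝ) (hsymm : ∀ v w, B v w = B w v)
    (hpos : ∀ v, v ≠ 0 → 0 < B v v) (A : End ℝ V) (hA : ∀ v w, B (A v) w = B v (A w))
    (hApos : ∀ v, v ≠ 0 → 0 < B (A v) v) :
    (∀ v w, B (invSqrt A v) w = B v (invSqrt A w)) ∧
    (∀ v, v ≠ 0 → 0 < B (invSqrt A v) v) ∧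
    (∀ v, A (invSqrt A (invSqrt A v)) = v) := by
  let core : InnerProductSpace.Core ℝ V :=
    { inner := fun v w => B v w
      conj_inner_symm := fun v w => by simpa using hsymm w v
      re_inner_nonneg := fun v => by
        rcases eq_or_ne v 0 with rfl | hv
        · simp
        · simpa using (hpos v hv).le
      add_left := fun u v w => by simp
      smul_left := fun u v r => by simp
      definite := fun v hv => by
        by_contra hne
        exact (hpos v hne).ne' hv }
  let _ : NormedAddCommGroup V := core.toNormedAddCommGroup
  let _ : InnerProductSpace ℝ V := InnerProductSpace.ofCore core.toCore
  have hin : ∀ v w : V, inner ℝ v w = B v w := fun _ _ => rfl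
  have hAs : LinearMap.IsSymmetric A := fun v w => hA v w
  let e := hAs.eigenvectorBasis rfl
  let l := hAs.eigenvalues rfl
  have he : ∀ i, A (e i) = l i • e i := fun i => by
    exact hAs.apply_eigenvectorBasis rfl i
  have hne : ∀ i, e i ≠ 0 := fun i => e.orthonormal.ne_zero i
  have hl : ∀ i, 0 < l i := fun i => by
    have := hApos (e i) (hne i)
    rw [he, map_smul, LinearMap.smul_apply, smul_eq_mul] at this
    exact pos_of_mul_pos_left this (hpos _ (hne i)).le
  have hS : ∀ i, invSqrt A (e i) = (Real.sqrt (l i))⁻¹ • e i := fun i =>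
    invSqrt_apply_eigenvector A (hne i) (he i)
  have hB : ∀ i j, B (e i) (e j) = if i = j then 1 else 0 := fun i j => by
    rw [← hin]; exact orthonormal_iff_ite.1 e.orthonormal i j
  have hsum : ∀ v, v = ∑ i, B (e i) v • e i := fun v => (e.sum_repr' v).symm
  have hSv : ∀ v, invSqrt A v = ∑ i, (B (e i) v * (Real.sqrt (l i))⁻¹) • e i := fun v => by
    conv_lhs => rw [hsum v]
    simp [map_sum, hS, smul_smul]
  have key : ∀ v w, B (invSqrt A v) w = ∑ i, B (e i) v * (Real.sqrt (l i))⁻¹ * B (e i) w := by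
    intro v w
    rw [hSv]
    simp
  refine ⟨fun v w => ?_, fun v hv => ?_, fun v => ?_⟩
  · rw [key, hsymm v, key]
    exact Finset.sum_congr rfl fun i _ => by ring
  · rw [key]
    obtain ⟨i, hi⟩ : ∃ i, B (e i) v ≠ 0 := by
      by_contra hcon
      push Not at hcon
      exact hv (by rw [hsum v]; simp [hcon])
    have hs : ∀ i, 0 < (Real.sqrt (l i))⁻¹ := fun i => inv_pos.2 (Real.sqrt_pos.2 (hl i))
    refine Finset.sum_pos' (fun j _ => ?_) ⟨i, Finset.mem_univ i, ?_⟩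
    · nlinarith [mul_nonneg (hs j).le (mul_self_nonneg (B (e j) v))]
    · nlinarith [mul_pos (hs i) (mul_self_pos.2 hi)]
  · have hbas : A ∘ₗ invSqrt A ∘ₗ invSqrt A = LinearMap.id := by
      refine e.toBasis.ext fun i => ?_
      have h0 : Real.sqrt (l i) * Real.sqrt (l i) = l i := Real.mul_self_sqrt (hl i).le
      simp only [OrthonormalBasis.coe_toBasis, LinearMap.comp_apply, hS, map_smul, he, smul_smul,
        LinearMap.id_apply]
      rw [← mul_inv, h0, inv_mul_cancel₀ (hl i).ne', one_smul]
    exact congrArg (fun F : End ℝ V => F v) hbas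

end LinearAlgebra

section Geometry

variable {E : Type*} [NormedAddCommGroup E] [NormedSpace ℝ E] [FiniteDimensional ℝ E]
  {H : Type*} [TopologicalSpace H] {I : ModelWithCorners ℝ E H}
  {M : Type*} [TopologicalSpace M] [ChartedSpace H M] [IsManifold I ∞ M]

instance (x : M) : FiniteDimensional ℝ (TangentSpace I x) :=
  inferInstanceAs (FiniteDimensional ℝ E)

instance (x : M) : T2Space (TangentSpace I x) :=
  inferInstanceAs (T2Space E)

variable (I M) in
/-- A smooth Riemannian metric on `M`. -/
abbrev Metric := ContMDiffRiemannianMetric I ∞ E (fun x : M => TangentSpace I x)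

variable (I M) in
/-- A (not necessarily smooth) vector field on `M`. -/
abbrev VField := (x : M) → TangentSpace I x

variable (I M) in
/-- A (not necessarily smooth) `(1,1)`-tensor field on `M`, as a field of endomorphisms. -/
abbrev Tensor11 := (x : M) → TangentSpace I x →L[ℝ] TangentSpace I x

/-- Smoothness of a vector field. -/
def SmoothVField (X : VField I M) : Prop :=
  ContMDiff I (I.prod 𝓘(ℝ, E)) ∞
    (fun x => TotalSpace.mk' E (E := fun y : M => TangentSpace I y) x (X x))

/-- Smoothness of a `(1,1)`-tensor field. -/
def SmoothTensor11 (T : Tensor11 I M) : Prop :=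
  ContMDiff I (I.prod 𝓘(ℝ, E →L[ℝ] E)) ∞ (fun x => TotalSpace.mk' (E →L[ℝ] E)
    (E := fun y : M => TangentSpace I y →L[ℝ] TangentSpace I y) x (T x))

variable (g : Metric I M)

theorem inner_isInvertible (x : M) : (g.inner x).IsInvertible := by
  have hinj : Function.Injective
      ((LinearMap.toContinuousLinearMap (𝕜 := ℝ) (E := TangentSpace I x) (F' := ℝ)).symm.toLinearMap
        ∘ₗ (g.inner x).toLinearMap) := by
    rw [injective_iff_map_eq_zero]
    intro v hv
    by_contra hne
    have h1 : g.inner x v v = 0 := by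
      simpa using congrArg (fun F : Dual ℝ (TangentSpace I x) => F v) hv
    exact (g.pos x v hne).ne' h1
  let L := (LinearEquiv.ofInjectiveOfFinrankEq _ hinj
    (Subspace.dual_finrank_eq (K := ℝ) (V := TangentSpace I x)).symm).trans
    (LinearMap.toContinuousLinearMap (𝕜 := ℝ) (E := TangentSpace I x) (F' := ℝ))
  refine ⟨L.toContinuousLinearEquiv, ?_⟩
  ext v w
  rfl

/-- The vector dual to a covector: `g (sharp g x α, v) = α v`. -/
def sharp (x : M) (α : TangentSpace I x →L[ℝ] ℝ) : TangentSpace I x :=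
  (g.inner x).inverse α

theorem inner_sharp (x : M) (α : TangentSpace I x →L[ℝ] ℝ) (v : TangentSpace I x) :
    g.inner x (sharp g x α) v = α v := by
  rw [sharp, (inner_isInvertible g x).self_apply_inverse]

/-- The gradient `∇f` of a function: `g (∇f, v) = df v`. -/
def grad (f : M → ℝ) : VField I M := fun x => sharp g x (mvfderiv I f x)

/-- The right-hand side of Koszul's formula for `g (∇_X Y, Z)`. -/
def koszul (X Y Z : VField I M) (x : M) : ℝ :=
  (mvfderiv I (fun y => g.inner y (Y y) (Z y)) x (X x)
    + mvfderiv I (fun y => g.inner y (X y) (Z y)) x (Y x)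
    - mvfderiv I (fun y => g.inner y (X y) (Y y)) x (Z x)
    + g.inner x (VectorField.mlieBracket I X Y x) (Z x)
    - g.inner x (VectorField.mlieBracket I X Z x) (Y x)
    - g.inner x (VectorField.mlieBracket I Y Z x) (X x)) / 2

/-- A basis of the tangent space at `x`. -/
def tbasis (x : M) : Basis (Fin (finrank ℝ E)) ℝ (TangentSpace I x) := finBasis ℝ E

/-- The vector field on a neighbourhood of `x` with value `v` at `x` and constant components in the
chart at `x`. -/
def extendVec {x : M} (v : TangentSpace I x) : VField I M :=
  FiberBundle.extend E (E := fun y : M => TangentSpace I y) v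

/-- The Levi-Civita connection of `g`: `leviCivita g Y x v` is `∇_v Y`, the vector given by Koszul's
formula. Koszul's expression is tensorial in its first and third argument when `Y` is differentiable
at `x`, so it may be evaluated on arbitrary extensions of tangent vectors; fixing its values on a
basis makes the result linear for every `Y`. -/
def leviCivita (Y : VField I M) (x : M) : TangentSpace I x →L[ℝ] TangentSpace I x :=
  LinearMap.toContinuousLinearMap ((tbasis x).constr ℝ fun i =>
    sharp g x (LinearMap.toContinuousLinearMap ((tbasis x).constr ℝ fun k =>
      koszul g (extendVec (tbasis x i)) Y (extendVec (tbasis x k)) x)))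

theorem mdifferentiableAt_inner {X Y : VField I M} {x : M} (hX : MDiffAt (T% X) x) (hY : MDiffAt (T% Y) x) :
    MDifferentiableAt I 𝓘(ℝ, ℝ) (fun y => g.inner y (X y) (Y y)) x := by
  have : MDifferentiableAt I (I.prod 𝓘(ℝ))
      (fun m ↦ TotalSpace.mk' ℝ (E := Bundle.Trivial M ℝ) m (g.inner m (X m) (Y m))) x := by
    apply MDifferentiableAt.clm_bundle_apply₂ (F₁ := E) (F₂ := E)
    · exact g.contMDiff.mdifferentiableAt (by simp)
    · exact hX
    · exact hY
  simp only [mdifferentiableAt_totalSpace] at this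
  exact this.2

theorem koszul_tensorial_thd {X Y : VField I M} {x : M} (hX : MDiffAt (T% X) x) (hY : MDiffAt (T% Y) x) :
    TensorialAt I E (fun Z => koszul g X Y Z x) x where
  smul {f Z} hf hZ := by
    have h1 := mvfderiv_fun_mul hf (mdifferentiableAt_inner g hY hZ)
    have h2 := mvfderiv_fun_mul hf (mdifferentiableAt_inner g hX hZ)
    simp only [koszul, Pi.smul_apply', map_smul, smul_eq_mul]
    rw [h1, h2, VectorField.mlieBracket_smul_right hf hZ, VectorField.mlieBracket_smul_right hf hZ]
    simp [g.symm x (Z x)]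
    ring
  add {Z Z'} hZ hZ' := by
    have h1 := mvfderiv_fun_add (mdifferentiableAt_inner g hY hZ) (mdifferentiableAt_inner g hY hZ')
    have h2 := mvfderiv_fun_add (mdifferentiableAt_inner g hX hZ) (mdifferentiableAt_inner g hX hZ')
    simp only [koszul, Pi.add_apply, map_add]
    rw [h1, h2, VectorField.mlieBracket_add_right hZ hZ', VectorField.mlieBracket_add_right hZ hZ']
    simp
    ring

theorem koszul_tensorial_fst {Y Z : VField I M} {x : M} (hY : MDiffAt (T% Y) x) (hZ : MDiffAt (T% Z) x) :
    TensorialAt I E (fun X => koszul g X Y Z x) x where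
  smul {f X} hf hX := by
    have h1 := mvfderiv_fun_mul hf (mdifferentiableAt_inner g hX hY)
    have h2 := mvfderiv_fun_mul hf (mdifferentiableAt_inner g hX hZ)
    simp only [koszul, Pi.smul_apply', map_smul, smul_eq_mul, _root_.smul_apply]
    rw [h1, h2, VectorField.mlieBracket_smul_left hf hX, VectorField.mlieBracket_smul_left hf hX]
    simp
    ring
  add {X X'} hX hX' := by
    have h1 := mvfderiv_fun_add (mdifferentiableAt_inner g hX hY) (mdifferentiableAt_inner g hX' hY)
    have h2 := mvfderiv_fun_add (mdifferentiableAt_inner g hX hZ) (mdifferentiableAt_inner g hX' hZ)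
    simp only [koszul, Pi.add_apply, map_add, _root_.add_apply]
    rw [h1, h2, VectorField.mlieBracket_add_left hX hX', VectorField.mlieBracket_add_left hX hX']
    simp
    ring

/-- Koszul's formula. -/
theorem inner_leviCivita {X Y Z : VField I M} {x : M} (hX : MDiffAt (T% X) x) (hY : MDiffAt (T% Y) x)
    (hZ : MDiffAt (T% Z) x) :
    g.inner x (leviCivita g Y x (X x)) (Z x) = koszul g X Y Z x := by
  let K := TensorialAt.mkHom₂ (V := fun y : M => TangentSpace I y)
    (V' := fun y : M => TangentSpace I y) (fun X Z => koszul g X Y Z x) x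
    (fun Z hZ => koszul_tensorial_fst g hY hZ) (fun X hX => koszul_tensorial_thd g hX hY)
  have hK : K (X x) (Z x) = koszul g X Y Z x :=
   TensorialAt.mkHom₂_apply (fun Z hZ => koszul_tensorial_fst g hY hZ) (fun X hX => koszul_tensorial_thd g hX hY) hX hZ
  rw [← hK]
  have : (g.inner x).toLinearMap ∘ₗ (leviCivita g Y x).toLinearMap = K.toLinearMap := by
    refine (tbasis x).ext fun i => ?_
    apply ContinuousLinearMap.coe_injective
    refine (tbasis x).ext fun k => ?_
    have : K (tbasis x i) (tbasis x k) =
        koszul g (extendVec (tbasis x i)) Y (extendVec (tbasis x k)) x := rfl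
    simp [leviCivita, inner_sharp, this]
  have h2 := congrArg (fun F => F (X x) (Z x)) this
  exact h2

/-- The connection is compatible with the metric. -/
theorem leviCivita_metric {X Y Z : VField I M} {x : M} (hX : MDiffAt (T% X) x) (hY : MDiffAt (T% Y) x)
    (hZ : MDiffAt (T% Z) x) :
    mvfderiv I (fun y => g.inner y (Y y) (Z y)) x (X x)
     = g.inner x (leviCivita g Y x (X x)) (Z x) + g.inner x (Y x) (leviCivita g Z x (X x)) := by
  rw [g.symm x (Y x), inner_leviCivita g hX hY hZ, inner_leviCivita g hX hZ hY]
  have e1 : (fun y => g.inner y (Z y) (Y y)) = (fun y => g.inner y (Y y) (Z y)) := by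
    ext y; exact g.symm _ _ _
  simp only [koszul, e1]
  rw [VectorField.mlieBracket_swap_apply (V := Z) (W := Y)]
  simp
  ring

/-- The connection is torsion-free. -/
theorem leviCivita_torsion {X Y : VField I M} {x : M} (hX : MDiffAt (T% X) x) (hY : MDiffAt (T% Y) x) :
    leviCivita g Y x (X x) - leviCivita g X x (Y x) = VectorField.mlieBracket I X Y x := by
  obtain ⟨L, hL⟩ := inner_isInvertible g x
  apply L.injective
  have hL' : ∀ v, L v = g.inner x v := fun v => by rw [← hL]; rfl
  rw [hL', hL']
  ext z
  have hz : FiberBundle.extend E (E := fun y : M => TangentSpace I y) z x = z := by simp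
  have hZ : MDiffAt (T% (FiberBundle.extend E (E := fun y : M => TangentSpace I y) z)) x :=
    FiberBundle.mdifferentiableAt_extend ..
  have a := inner_leviCivita g hX hY hZ
  have b := inner_leviCivita g hY hX hZ
  rw [hz] at a b
  rw [map_sub, _root_.sub_apply, a, b]
  have e1 : (fun y => g.inner y (Y y) (X y)) = (fun y => g.inner y (X y) (Y y)) := by
    ext y; exact g.symm _ _ _
  simp only [koszul, e1]
  rw [VectorField.mlieBracket_swap_apply (V := Y) (W := X), hz]
  simp
  ring
/-- The divergence `∇_i X^i` of a vector field. -/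
def divergence (X : VField I M) (x : M) : ℝ :=
  LinearMap.trace ℝ (TangentSpace I x) (leviCivita g X x)

/-- The Laplacian `Δ f = div (∇f)`. -/
def laplacian (f : M → ℝ) (x : M) : ℝ := divergence g (grad g f) x

/-- The Hessian `∇∇f (v, w) = g (∇_v (∇f), w)`. -/
def hessian (f : M → ℝ) (x : M) (v w : TangentSpace I x) : ℝ :=
  g.inner x (leviCivita g (grad g f) x v) w

/-- The components `e_i ↦ C_{ij} = g (e_i, C e_j)` of a `(1,1)`-tensor in a basis. In an orthonormal
basis the position of the indices is immaterial. -/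
def components (C : Tensor11 I M) (x : M) {ι : Type*} (e : ι → TangentSpace I x) (i j : ι) : ℝ :=
  g.inner x (e i) (C x (e j))

/-- Covariant derivative of a `(1,1)`-tensor: `v ↦ (∇_v T) w = ∇_v (T W) - T (∇_v W)`, where `W` is
an extension of `w`. -/
def covTensor (T : Tensor11 I M) (x : M) (w : TangentSpace I x) :
    TangentSpace I x →L[ℝ] TangentSpace I x :=
  leviCivita g (fun y => T y (extendVec w y)) x - T x ∘L leviCivita g (extendVec w) x

/-- The divergence `V^j = ∇_i T^{ij}` of a `(1,1)`-tensor: the vector field dual to the one-form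
`w ↦ tr (v ↦ (∇_v T) w)`. -/
def divTensor (T : Tensor11 I M) : VField I M := fun x =>
  sharp g x (LinearMap.toContinuousLinearMap ((tbasis x).constr ℝ fun k =>
    LinearMap.trace ℝ (TangentSpace I x) (covTensor g T x (tbasis x k))))

/-- The double divergence `∑ ∇_j ∇_i T_{ij}` of a `(1,1)`-tensor. -/
def divDiv (T : Tensor11 I M) (x : M) : ℝ := divergence g (divTensor g T) x

/-- The `(1,1)`-tensor `C` is symmetric and positive definite with respect to `g`. -/
structure IsSymmPosDef (C : Tensor11 I M) : Prop where
  symm : ∀ x v w, g.inner x (C x v) w = g.inner x v (C x w)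
  pos : ∀ x v, v ≠ 0 → 0 < g.inner x (C x v) v

/-- The Riemannian metric `g'` is `C^{-1/2} g C^{-1/2}`. -/
def IsChangeOfMetric (C : Tensor11 I M) (g' : Metric I M) : Prop :=
  ∀ x u v, g'.inner x u v =
    g.inner x (invSqrt (C x).toLinearMap u) (invSqrt (C x).toLinearMap v)

/-- The basis `e` of the tangent space at `x` is orthonormal for `g`. -/
def IsOrthonormal (x : M) {ι : Type*} [DecidableEq ι] (e : ι → TangentSpace I x) : Prop :=
  ∀ i j, g.inner x (e i) (e j) = if i = j then 1 else 0

/-- The determinant `|g|` of the metric in a basis of the tangent space. -/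
def metricDet (x : M) {ι : Type*} [Fintype ι] [DecidableEq ι] (e : ι → TangentSpace I x) : ℝ :=
  (Matrix.of fun i j => g.inner x (e i) (e j)).det

/-- The function `√|C|`. -/
def sqrtDet (C : Tensor11 I M) (x : M) : ℝ := Real.sqrt (LinearMap.det (C x).toLinearMap)

end Geometry

end RiemannianOps

end

/-!
With `ρ = √|C|`, the metric `g' (u, v) = g (C^{-1/2} u, C^{-1/2} v) = g (C⁻¹ u, v)` satisfies
`g' (C u, v) = g (u, v)`, and this relation is all that the identities need. The gradient of `g'` is
`∇'f = C ∇f`, and its Gram determinant in any basis is `|g| / ρ²`.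

In a local frame `(e_i)` with dual frame `(θ^i)`, Koszul's formula gives
`div X = ∑ θ^i [e_i, X] + ½ X (log |g|)` (`divergence_eq_sum_mlieBracket`). The first term does not
involve the metric, so by Jacobi's formula `div' X = div X - X (log ρ)` (`divergence_of_inner`),
or equivalently `div' (ρ Z) = ρ div Z` (`divergence_smul_sqrtDet`).

Together with the Leibniz rules `div (C Y) = tr (C ∇Y) + g (div C, Y)` (`inner_divTensor`) and
`div (f C) = f div C + C ∇f` (`divTensor_smul`), this determines the vector field
`κ = C ∇(log ρ) - div C`:
* `Δ' f = div (C ∇f) - g (C ∇(log ρ), ∇f) = tr (C ∇∇f) - g (κ, ∇f)`;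
* `ρ⁻¹ Δ' (ρ f) = div (C ∇f + f C ∇(log ρ)) = div (div (f C)) + div (f κ)`.

Smoothness of `g'` holds because inversion of linear maps is smooth. A vector field is smooth once
its inner products with a smooth frame are (`contMDiffAt_of_inner_frame`); for `div C` these are
combinations of Koszul expressions in the frame.
-/

namespace RiemannianOps

/-! ### Gram matrices -/

section GramMatrix

variable {V : Type*} [AddCommGroup V] [Module ℝ V] {ι : Type*} [Fintype ι] [DecidableEq ι]

/-- The inverse Gram matrix recovers the coordinates of a vector from its products with a basis. -/
theorem sum_inv_gram_mul (B : V →ₗ[ℝ] V →ₗ[ℝ] ℝ) (b : Basis ι ℝ V)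
    (hB : (Matrix.of fun i j => B (b i) (b j)).det ≠ 0) (w : V) (i : ι) :
    ∑ j, (Matrix.of fun i j => B (b i) (b j))⁻¹ j i * B w (b j) = b.repr w i := by
  set G := Matrix.of fun i j => B (b i) (b j) with hG
  have hw : ∀ j, B w (b j) = ∑ k, b.repr w k * G k j := fun j => by
    conv_lhs => rw [← b.sum_repr w]
    simp only [map_sum, map_smul, LinearMap.sum_apply, LinearMap.smul_apply, smul_eq_mul, hG,
      Matrix.of_apply]
  have hGG : G * G⁻¹ = 1 := Matrix.mul_nonsing_inv G (isUnit_iff_ne_zero.2 hB)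
  calc ∑ j, G⁻¹ j i * B w (b j) = ∑ j, ∑ k, b.repr w k * (G k j * G⁻¹ j i) := by
        simp_rw [hw, Finset.mul_sum]
        exact Finset.sum_congr rfl fun j _ => Finset.sum_congr rfl fun k _ => by ring
    _ = ∑ k, b.repr w k * (G * G⁻¹) k i := by
        rw [Finset.sum_comm]
        simp_rw [Matrix.mul_apply, Finset.mul_sum]
    _ = b.repr w i := by simp [hGG, Matrix.one_apply]

theorem det_gram_pos (B : V →ₗ[ℝ] V →ₗ[ℝ] ℝ) (hsymm : ∀ v w, B v w = B w v)
    (hpos : ∀ v, v ≠ 0 → 0 < B v v) (b : Basis ι ℝ V) :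
    0 < (Matrix.of fun i j => B (b i) (b j)).det := by
  refine Matrix.PosDef.det_pos (Matrix.PosDef.of_dotProduct_mulVec_pos ?_ fun c hc => ?_)
  · ext i j
    simp [hsymm (b i)]
  · have hne : ∑ i, c i • b i ≠ 0 := fun h =>
      hc (funext fun i => by simpa using (Fintype.linearIndependent_iff.1 b.linearIndependent) c h i)
    have h := hpos _ hne
    simp only [map_sum, LinearMap.sum_apply, map_smul, LinearMap.smul_apply, smul_eq_mul,
      Finset.mul_sum] at h
    rw [Finset.sum_comm] at h
    simpa [dotProduct, Matrix.mulVec, Finset.mul_sum, mul_comm, mul_left_comm] using h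

theorem det_gram_comp (B B' : V →ₗ[ℝ] V →ₗ[ℝ] ℝ) (C : End ℝ V)
    (h : ∀ v w, B' (C v) w = B v w) (b : Basis ι ℝ V) :
    (Matrix.of fun i j => B (b i) (b j)).det =
      LinearMap.det C * (Matrix.of fun i j => B' (b i) (b j)).det := by
  rw [← LinearMap.det_toMatrix b, ← Matrix.det_transpose (LinearMap.toMatrix b b C),
    ← Matrix.det_mul]
  congr 1
  ext i j
  have hC : C (b i) = ∑ k, LinearMap.toMatrix b b C k i • b k := by
    conv_lhs => rw [← b.sum_repr (C (b i))]
    simp [LinearMap.toMatrix_apply]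
  rw [Matrix.of_apply, ← h, hC]
  simp [Matrix.mul_apply]

end GramMatrix

/-! ### Derivatives of determinants -/

section Jacobi

variable {E : Type*} [NormedAddCommGroup E] [NormedSpace ℝ E]
  {H : Type*} [TopologicalSpace H] {I : ModelWithCorners ℝ E H}
  {M : Type*} [TopologicalSpace M] [ChartedSpace H M] {x : M} {ι : Type*}

theorem mdifferentiableAt_finset_sum {s : Finset ι} {f : ι → M → ℝ}
    (hf : ∀ i ∈ s, MDifferentiableAt I 𝓘(ℝ, ℝ) (f i) x) :
    MDifferentiableAt I 𝓘(ℝ, ℝ) (fun y => ∑ i ∈ s, f i y) x := by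
  classical
  induction s using Finset.induction_on with
  | empty => simpa using mdifferentiableAt_const
  | insert a s ha ih =>
    simp only [Finset.sum_insert ha]
    exact (hf a (by simp)).add (ih fun i hi => hf i (by simp [hi]))

theorem mvfderiv_finset_sum {s : Finset ι} {f : ι → M → ℝ}
    (hf : ∀ i ∈ s, MDifferentiableAt I 𝓘(ℝ, ℝ) (f i) x) (v : TangentSpace I x) :
    mvfderiv I (fun y => ∑ i ∈ s, f i y) x v = ∑ i ∈ s, mvfderiv I (f i) x v := by
  classical
  induction s using Finset.induction_on with
  | empty => simp [mvfderiv_const]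
  | insert a s ha ih =>
    simp only [Finset.sum_insert ha]
    rw [mvfderiv_fun_add (hf a (by simp))
      (mdifferentiableAt_finset_sum fun i hi => hf i (by simp [hi])),
      _root_.add_apply, ih fun i hi => hf i (by simp [hi])]

theorem mdifferentiableAt_finset_prod {s : Finset ι} {f : ι → M → ℝ}
    (hf : ∀ i ∈ s, MDifferentiableAt I 𝓘(ℝ, ℝ) (f i) x) :
    MDifferentiableAt I 𝓘(ℝ, ℝ) (fun y => ∏ i ∈ s, f i y) x := by
  classical
  induction s using Finset.induction_on with
  | empty => simpa using mdifferentiableAt_const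
  | insert a s ha ih =>
    simp only [Finset.prod_insert ha]
    exact (hf a (by simp)).mul (ih fun i hi => hf i (by simp [hi]))

theorem mvfderiv_finset_prod [DecidableEq ι] {s : Finset ι} {f : ι → M → ℝ}
    (hf : ∀ i ∈ s, MDifferentiableAt I 𝓘(ℝ, ℝ) (f i) x) (v : TangentSpace I x) :
    mvfderiv I (fun y => ∏ i ∈ s, f i y) x v =
      ∑ k ∈ s, mvfderiv I (f k) x v * ∏ i ∈ s.erase k, f i x := by
  induction s using Finset.induction_on with
  | empty => simp [mvfderiv_const]
  | insert a s ha ih =>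
    have hs : ∀ i ∈ s, MDifferentiableAt I 𝓘(ℝ, ℝ) (f i) x := fun i hi => hf i (by simp [hi])
    simp only [Finset.prod_insert ha]
    rw [mvfderiv_fun_mul (hf a (by simp)) (mdifferentiableAt_finset_prod hs), _root_.add_apply,
      _root_.smul_apply, _root_.smul_apply, ih hs, Finset.sum_insert ha, Finset.erase_insert ha,
      smul_eq_mul, smul_eq_mul, Finset.mul_sum, add_comm, mul_comm]
    congr 1
    refine Finset.sum_congr rfl fun k hk => ?_
    have hka : a ≠ k := fun h => ha (h ▸ hk)
    rw [Finset.erase_insert_of_ne hka, Finset.prod_insert (by simp [ha])]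
    ring

/-- Jacobi's formula for the derivative of a determinant. -/
theorem mvfderiv_det [Fintype ι] [DecidableEq ι] {A : M → Matrix ι ι ℝ}
    (hA : ∀ i j, MDifferentiableAt I 𝓘(ℝ, ℝ) (fun y => A y i j) x) (v : TangentSpace I x) :
    mvfderiv I (fun y => (A y).det) x v =
      ∑ i, ∑ j, (A x).adjugate j i * mvfderiv I (fun y => A y i j) x v := by
  have hprod : ∀ σ : Equiv.Perm ι,
      MDifferentiableAt I 𝓘(ℝ, ℝ) (fun y => ∏ i, A y (σ i) i) x := fun σ =>
    mdifferentiableAt_finset_prod fun i _ => hA (σ i) i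
  have hcol : ∀ k, ((A x).updateCol k fun i => mvfderiv I (fun y => A y i k) x v).det =
      ∑ σ : Equiv.Perm ι, (Equiv.Perm.sign σ : ℝ) *
        (mvfderiv I (fun y => A y (σ k) k) x v * ∏ i ∈ Finset.univ.erase k, A x (σ i) i) := by
    intro k
    rw [Matrix.det_apply']
    refine Finset.sum_congr rfl fun σ _ => ?_
    rw [← Finset.mul_prod_erase _ _ (Finset.mem_univ k), Matrix.updateCol_self]
    congr 2
    exact Finset.prod_congr rfl fun i hi => by
      rw [Matrix.updateCol_ne (Finset.ne_of_mem_erase hi)]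
  have hsmul : ∀ σ : Equiv.Perm ι, MDifferentiableAt I 𝓘(ℝ, ℝ)
      (fun y => ((Equiv.Perm.sign σ : ℤ) : ℝ) * ∏ i, A y (σ i) i) x := fun σ =>
    MDifferentiableAt.mul mdifferentiableAt_const (hprod σ)
  simp_rw [Matrix.det_apply']
  rw [mvfderiv_finset_sum fun σ _ => hsmul σ]
  have hterm : ∀ σ : Equiv.Perm ι,
      mvfderiv I (fun y => ((Equiv.Perm.sign σ : ℤ) : ℝ) * ∏ i, A y (σ i) i) x v =
      ∑ k, (Equiv.Perm.sign σ : ℝ) *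
        (mvfderiv I (fun y => A y (σ k) k) x v * ∏ i ∈ Finset.univ.erase k, A x (σ i) i) := by
    intro σ
    rw [mvfderiv_fun_mul mdifferentiableAt_const (hprod σ), mvfderiv_const, _root_.add_apply,
      _root_.smul_apply, mvfderiv_finset_prod fun i _ => hA (σ i) i, smul_eq_mul, Finset.mul_sum]
    simp
  simp_rw [hterm]
  -- The terms that differentiate the `k`-th column form the determinant with that column replaced.
  refine Eq.trans Finset.sum_comm (Eq.trans (Finset.sum_congr rfl fun k _ => ?_) Finset.sum_comm)
  rw [← hcol, ← Matrix.cramer_apply, Matrix.cramer_eq_adjugate_mulVec]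
  rfl

/-- Jacobi's formula, as the logarithmic derivative of a nonvanishing determinant. -/
theorem sum_inv_mul_mvfderiv [Fintype ι] [DecidableEq ι] {A : M → Matrix ι ι ℝ}
    (hA : ∀ i j, MDifferentiableAt I 𝓘(ℝ, ℝ) (fun y => A y i j) x) (v : TangentSpace I x) :
    ∑ i, ∑ j, (A x)⁻¹ j i * mvfderiv I (fun y => A y i j) x v =
      ((A x).det)⁻¹ * mvfderiv I (fun y => (A y).det) x v := by
  rw [mvfderiv_det hA, Finset.mul_sum]
  refine Finset.sum_congr rfl fun i _ => ?_
  rw [Finset.mul_sum]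
  refine Finset.sum_congr rfl fun j _ => ?_
  rw [Matrix.inv_def, Ring.inverse_eq_inv', Matrix.smul_apply, smul_eq_mul, mul_assoc]

theorem contMDiffAt_det [Fintype ι] [DecidableEq ι] {A : M → Matrix ι ι ℝ}
    (hA : ∀ i j, ContMDiffAt I 𝓘(ℝ, ℝ) ∞ (fun y => A y i j) x) :
    ContMDiffAt I 𝓘(ℝ, ℝ) ∞ (fun y => (A y).det) x := by
  simp_rw [Matrix.det_apply']
  exact contMDiffAt_finsetSum fun σ _ => contMDiffAt_const.mul
    (contMDiffAt_finsetProd fun i _ => hA (σ i) i)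

theorem contMDiffAt_matrix_inv [Fintype ι] [DecidableEq ι] {A : M → Matrix ι ι ℝ}
    (hA : ∀ i j, ContMDiffAt I 𝓘(ℝ, ℝ) ∞ (fun y => A y i j) x) (hdet : (A x).det ≠ 0) (i j : ι) :
    ContMDiffAt I 𝓘(ℝ, ℝ) ∞ (fun y => (A y)⁻¹ i j) x := by
  simp_rw [Matrix.inv_def, Ring.inverse_eq_inv', Matrix.smul_apply, smul_eq_mul,
    Matrix.adjugate_apply]
  refine ((contMDiffAt_det hA).inv₀ hdet).mul (contMDiffAt_det fun k l => ?_)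
  by_cases hk : k = j
  · subst hk
    simpa using contMDiffAt_const
  · simpa [Matrix.updateRow_ne hk] using hA k l

end Jacobi

/-! ### Smoothness of inner products, derivatives and brackets -/

section Smoothness

variable {E : Type*} [NormedAddCommGroup E] [NormedSpace ℝ E] [FiniteDimensional ℝ E]
  {H : Type*} [TopologicalSpace H] {I : ModelWithCorners ℝ E H}
  {M : Type*} [TopologicalSpace M] [ChartedSpace H M] [IsManifold I ∞ M]
  {x : M}

omit [FiniteDimensional ℝ E] in
theorem contMDiffAt_inner (g : Metric I M) {X Y : VField I M}
    (hX : CMDiffAt ∞ (T% X) x) (hY : CMDiffAt ∞ (T% Y) x) :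
    ContMDiffAt I 𝓘(ℝ, ℝ) ∞ (fun y => g.inner y (X y) (Y y)) x := by
  have : ContMDiffAt I (I.prod 𝓘(ℝ)) ∞
      (fun m ↦ TotalSpace.mk' ℝ (E := Bundle.Trivial M ℝ) m (g.inner m (X m) (Y m))) x := by
    apply ContMDiffAt.clm_bundle_apply₂ (F₁ := E) (F₂ := E)
    · exact g.contMDiff.contMDiffAt
    · exact hX
    · exact hY
  simp only [contMDiffAt_totalSpace] at this
  exact this.2

omit [FiniteDimensional ℝ E] in
theorem contMDiffAt_tensor_apply {T : Tensor11 I M} (hT : SmoothTensor11 T) {X : VField I M}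
    (hX : CMDiffAt ∞ (T% X) x) : CMDiffAt ∞ (T% (fun y => T y (X y))) x :=
  ContMDiffAt.clm_bundle_apply (F₁ := E) (F₂ := E) (E₁ := fun y : M => TangentSpace I y)
    (E₂ := fun y : M => TangentSpace I y) hT.contMDiffAt hX

omit [FiniteDimensional ℝ E] in
theorem contMDiffAt_mvfderiv_apply {f : M → ℝ} (hf : ContMDiffAt I 𝓘(ℝ, ℝ) ∞ f x)
    {X : VField I M} (hX : CMDiffAt ∞ (T% X) x) :
    ContMDiffAt I 𝓘(ℝ, ℝ) ∞ (fun y => mvfderiv I f y (X y)) x := by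
  -- `df` is smooth in tangent coordinates, so `df (X)` is a smooth section of `T ℝ` along `f`.
  have h := hf.mfderiv_const (m := ∞) (by simp)
  have h2 := ContMDiffAt.clm_apply_of_inCoordinates (b₁ := id) (b₂ := f) h hX hf
  rw [contMDiffAt_totalSpace] at h2
  have h3 := h2.2
  simp only [trivializationAt_model_space_apply] at h3
  exact h3

theorem contMDiffAt_mlieBracket {X Y : VField I M}
    (hX : CMDiffAt ∞ (T% X) x) (hY : CMDiffAt ∞ (T% Y) x) :
    CMDiffAt ∞ (T% (VectorField.mlieBracket I X Y)) x := by
  have : IsManifold I (((⊤ : ℕ∞) : ℕ∞ω) + 1) M := by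
    simpa using (inferInstance : IsManifold I ∞ M)
  have : IsManifold I (minSmoothness ℝ 2) M := by
    rw [minSmoothness_of_isRCLikeNormedField]
    infer_instance
  exact ContMDiffAt.mlieBracket_vectorField (n := ⊤) (m := ⊤) hX hY (by simp)

theorem contMDiffAt_koszul (g : Metric I M) {X Y Z : VField I M}
    (hX : CMDiffAt ∞ (T% X) x) (hY : CMDiffAt ∞ (T% Y) x) (hZ : CMDiffAt ∞ (T% Z) x) :
    ContMDiffAt I 𝓘(ℝ, ℝ) ∞ (koszul g X Y Z) x := by
  have h := (((((contMDiffAt_mvfderiv_apply (contMDiffAt_inner g hY hZ) hX).add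
    (contMDiffAt_mvfderiv_apply (contMDiffAt_inner g hX hZ) hY)).sub
    (contMDiffAt_mvfderiv_apply (contMDiffAt_inner g hX hY) hZ)).add
    (contMDiffAt_inner g (contMDiffAt_mlieBracket hX hY) hZ)).sub
    (contMDiffAt_inner g (contMDiffAt_mlieBracket hX hZ) hY)).sub
    (contMDiffAt_inner g (contMDiffAt_mlieBracket hY hZ) hX)
  exact h.div_const 2

end Smoothness

/-! ### Composition and inversion of bundle maps -/

section HomBundle

variable {EB B F₁ F₂ F₃ : Type*} [NormedAddCommGroup EB] [NormedSpace ℝ EB]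
  {HB : Type*} [TopologicalSpace HB] {IB : ModelWithCorners ℝ EB HB}
  [TopologicalSpace B] [ChartedSpace HB B] {n : ℕ∞ω}
  {E₁ : B → Type*} [∀ x, AddCommGroup (E₁ x)] [∀ x, Module ℝ (E₁ x)]
  [NormedAddCommGroup F₁] [NormedSpace ℝ F₁]
  [TopologicalSpace (TotalSpace F₁ E₁)] [∀ x, TopologicalSpace (E₁ x)]
  [FiberBundle F₁ E₁] [VectorBundle ℝ F₁ E₁]
  {E₂ : B → Type*} [∀ x, AddCommGroup (E₂ x)] [∀ x, Module ℝ (E₂ x)]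
  [NormedAddCommGroup F₂] [NormedSpace ℝ F₂]
  [TopologicalSpace (TotalSpace F₂ E₂)] [∀ x, TopologicalSpace (E₂ x)]
  [∀ x, IsTopologicalAddGroup (E₂ x)] [∀ x, ContinuousSMul ℝ (E₂ x)]
  [FiberBundle F₂ E₂] [VectorBundle ℝ F₂ E₂]
  {E₃ : B → Type*} [∀ x, AddCommGroup (E₃ x)] [∀ x, Module ℝ (E₃ x)]
  [NormedAddCommGroup F₃] [NormedSpace ℝ F₃]
  [TopologicalSpace (TotalSpace F₃ E₃)] [∀ x, TopologicalSpace (E₃ x)]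
  [∀ x, IsTopologicalAddGroup (E₃ x)] [∀ x, ContinuousSMul ℝ (E₃ x)]
  [FiberBundle F₃ E₃] [VectorBundle ℝ F₃ E₃] {x : B}

/-- The composition of two smooth families of linear maps between vector bundles is smooth. -/
theorem contMDiffAt_clm_bundle_comp {φ : ∀ x, E₂ x →L[ℝ] E₃ x} {ψ : ∀ x, E₁ x →L[ℝ] E₂ x}
    (hφ : ContMDiffAt IB (IB.prod 𝓘(ℝ, F₂ →L[ℝ] F₃)) n
      (fun y => TotalSpace.mk' (F₂ →L[ℝ] F₃) (E := fun y => E₂ y →L[ℝ] E₃ y) y (φ y)) x)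
    (hψ : ContMDiffAt IB (IB.prod 𝓘(ℝ, F₁ →L[ℝ] F₂)) n
      (fun y => TotalSpace.mk' (F₁ →L[ℝ] F₂) (E := fun y => E₁ y →L[ℝ] E₂ y) y (ψ y)) x) :
    ContMDiffAt IB (IB.prod 𝓘(ℝ, F₁ →L[ℝ] F₃)) n
      (fun y => TotalSpace.mk' (F₁ →L[ℝ] F₃) (E := fun y => E₁ y →L[ℝ] E₃ y) y
        (φ y ∘L ψ y)) x := by
  rw [contMDiffAt_hom_bundle] at hφ hψ ⊢
  refine ⟨contMDiffAt_id, (hφ.2.clm_comp hψ.2).congr_of_eventuallyEq ?_⟩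
  filter_upwards [(trivializationAt F₂ E₂ x).open_baseSet.mem_nhds
    (FiberBundle.mem_baseSet_trivializationAt F₂ E₂ x)] with y hy
  ext v
  exact congrArg (fun w => (trivializationAt F₃ E₃ x).continuousLinearMapAt ℝ y (φ y w))
    (Trivialization.symmL_continuousLinearMapAt (R := ℝ) _ hy _).symm

/-- The pointwise inverse of a smooth family of invertible linear maps between vector bundles is
smooth. -/
theorem contMDiffAt_clm_bundle_inverse [CompleteSpace F₁]
    [∀ x, IsTopologicalAddGroup (E₁ x)] [∀ x, ContinuousSMul ℝ (E₁ x)]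
    {φ : ∀ x, E₁ x →L[ℝ] E₂ x} (hinv : ∀ x, (φ x).IsInvertible)
    (hφ : ContMDiffAt IB (IB.prod 𝓘(ℝ, F₁ →L[ℝ] F₂)) n
      (fun y => TotalSpace.mk' (F₁ →L[ℝ] F₂) (E := fun y => E₁ y →L[ℝ] E₂ y) y (φ y)) x) :
    ContMDiffAt IB (IB.prod 𝓘(ℝ, F₂ →L[ℝ] F₁)) n
      (fun y => TotalSpace.mk' (F₂ →L[ℝ] F₁) (E := fun y => E₂ y →L[ℝ] E₁ y) y
        (φ y).inverse) x := by
  have h1 := FiberBundle.mem_baseSet_trivializationAt F₁ E₁ x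
  have h2 := FiberBundle.mem_baseSet_trivializationAt F₂ E₂ x
  -- In trivializations, a fibrewise isomorphism is an isomorphism of the model fibres.
  have key : ∀ y (hy1 : y ∈ (trivializationAt F₁ E₁ x).baseSet)
      (hy2 : y ∈ (trivializationAt F₂ E₂ x).baseSet), ∃ L : F₁ ≃L[ℝ] F₂,
      ContinuousLinearMap.inCoordinates F₁ E₁ F₂ E₂ x y x y (φ y) = L ∧
      ContinuousLinearMap.inCoordinates F₂ E₂ F₁ E₁ x y x y (φ y).inverse = L.symm := by
    intro y hy1 hy2
    obtain ⟨A, hA⟩ := hinv y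
    refine ⟨((Trivialization.continuousLinearEquivAt ℝ _ y hy1).symm.trans A).trans
      (Trivialization.continuousLinearEquivAt ℝ _ y hy2), ?_, ?_⟩
    · rw [ContinuousLinearMap.inCoordinates_eq hy1 hy2, ← hA]
      rfl
    · rw [ContinuousLinearMap.inCoordinates_eq hy2 hy1, ← hA, ContinuousLinearMap.inverse_equiv]
      rfl
  rw [contMDiffAt_hom_bundle] at hφ ⊢
  refine ⟨contMDiffAt_id, ?_⟩
  obtain ⟨L, hL, -⟩ := key x h1 h2
  have hsm : ContDiffAt ℝ n ContinuousLinearMap.inverse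
      (ContinuousLinearMap.inCoordinates F₁ E₁ F₂ E₂ x x x x (φ x)) := by
    rw [hL]
    exact contDiffAt_map_inverse L
  refine (hsm.contMDiffAt.comp x hφ.2).congr_of_eventuallyEq ?_
  filter_upwards [(trivializationAt F₁ E₁ x).open_baseSet.mem_nhds h1,
    (trivializationAt F₂ E₂ x).open_baseSet.mem_nhds h2] with y hy1 hy2
  obtain ⟨L, hL, hL'⟩ := key y hy1 hy2
  simp [hL, hL']

end HomBundle

/-! ### Leibniz rules for the Levi-Civita connection -/

section Connection

variable {E : Type*} [NormedAddCommGroup E] [NormedSpace ℝ E] [FiniteDimensional ℝ E]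
  {H : Type*} [TopologicalSpace H] {I : ModelWithCorners ℝ E H}
  {M : Type*} [TopologicalSpace M] [ChartedSpace H M] [IsManifold I ∞ M]
  (g : Metric I M) {x : M}

omit [FiniteDimensional ℝ E] in
theorem inner_left_cancel {u v : TangentSpace I x} (h : ∀ w, g.inner x u w = g.inner x v w) :
    u = v := by
  by_contra hne
  refine (g.pos x (u - v) (sub_ne_zero.2 hne)).ne' ?_
  have h0 : g.inner x (u - v) = 0 := by
    ext w
    simp [h]
  rw [h0, _root_.zero_apply]

omit [FiniteDimensional ℝ E] in
theorem mdifferentiableAt_extendVec (v : TangentSpace I x) :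
    MDiffAt (T% (extendVec (I := I) v)) x :=
  FiberBundle.mdifferentiableAt_extend ..

omit [FiniteDimensional ℝ E] in
@[simp]
theorem extendVec_self (v : TangentSpace I x) : extendVec (I := I) v x = v :=
  FiberBundle.extend_apply_self ..

theorem inner_leviCivita_apply {Y : VField I M} (hY : MDiffAt (T% Y) x)
    (v w : TangentSpace I x) :
    g.inner x (leviCivita g Y x v) w = koszul g (extendVec v) Y (extendVec w) x := by
  have h := inner_leviCivita g (mdifferentiableAt_extendVec v) hY (mdifferentiableAt_extendVec w)
  rwa [extendVec_self, extendVec_self] at h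

theorem leviCivita_add {Y Z : VField I M} (hY : MDiffAt (T% Y) x) (hZ : MDiffAt (T% Z) x) :
    leviCivita g (fun y => Y y + Z y) x = leviCivita g Y x + leviCivita g Z x := by
  ext v
  refine inner_left_cancel g fun w => ?_
  have hv := mdifferentiableAt_extendVec (I := I) v
  have hw := mdifferentiableAt_extendVec (I := I) w
  have hYZ : MDiffAt (T% (Y + Z)) x := mdifferentiableAt_add_section hY hZ
  change g.inner x (leviCivita g (Y + Z) x v) w = _
  rw [_root_.add_apply, map_add, _root_.add_apply, inner_leviCivita_apply g hYZ,
    inner_leviCivita_apply g hY, inner_leviCivita_apply g hZ]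
  have h1 := mvfderiv_fun_add (mdifferentiableAt_inner g hY hw) (mdifferentiableAt_inner g hZ hw)
  have h2 := mvfderiv_fun_add (mdifferentiableAt_inner g hv hY) (mdifferentiableAt_inner g hv hZ)
  simp only [koszul, Pi.add_apply, map_add, _root_.add_apply]
  rw [h1, h2, VectorField.mlieBracket_add_left hY hZ, VectorField.mlieBracket_add_right hY hZ]
  simp
  ring

theorem leviCivita_smul {f : M → ℝ} {Y : VField I M} (hf : MDifferentiableAt I 𝓘(ℝ, ℝ) f x)
    (hY : MDiffAt (T% Y) x) :
    leviCivita g (fun y => f y • Y y) x =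
      f x • leviCivita g Y x + (mvfderiv I f x).smulRight (Y x) := by
  ext v
  refine inner_left_cancel g fun w => ?_
  have hv := mdifferentiableAt_extendVec (I := I) v
  have hw := mdifferentiableAt_extendVec (I := I) w
  have hfY : MDiffAt (T% (f • Y)) x := hf.smul_section hY
  change g.inner x (leviCivita g (f • Y) x v) w = _
  rw [_root_.add_apply, map_add, _root_.add_apply, _root_.smul_apply, map_smul,
    _root_.smul_apply, ContinuousLinearMap.smulRight_apply, map_smul, _root_.smul_apply,
    inner_leviCivita_apply g hfY, inner_leviCivita_apply g hY]
  have h1 := mvfderiv_fun_mul hf (mdifferentiableAt_inner g hY hw)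
  have h2 := mvfderiv_fun_mul hf (mdifferentiableAt_inner g hv hY)
  simp only [koszul, Pi.smul_apply', map_smul, smul_eq_mul, _root_.smul_apply]
  rw [h1, h2, VectorField.mlieBracket_smul_left hf hY, VectorField.mlieBracket_smul_right hf hY]
  simp [g.symm x v]
  ring

theorem divergence_add {Y Z : VField I M} (hY : MDiffAt (T% Y) x) (hZ : MDiffAt (T% Z) x) :
    divergence g (fun y => Y y + Z y) x = divergence g Y x + divergence g Z x := by
  simp only [divergence]
  rw [leviCivita_add g hY hZ, ← map_add]
  rfl

theorem divergence_smul {f : M → ℝ} {Y : VField I M} (hf : MDifferentiableAt I 𝓘(ℝ, ℝ) f x)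
    (hY : MDiffAt (T% Y) x) :
    divergence g (fun y => f y • Y y) x = f x * divergence g Y x + mvfderiv I f x (Y x) := by
  simp only [divergence]
  rw [leviCivita_smul g hf hY]
  have h : ((f x • leviCivita g Y x + (mvfderiv I f x).smulRight (Y x) :
      TangentSpace I x →L[ℝ] TangentSpace I x) : TangentSpace I x →ₗ[ℝ] TangentSpace I x) =
      f x • (leviCivita g Y x).toLinearMap +
        (mvfderiv I f x).toLinearMap.smulRight (Y x) := rfl
  rw [h, map_add, map_smul, LinearMap.trace_smulRight]
  rfl

end Connection

/-! ### The divergence in a local frame -/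

section Frame

variable {E : Type*} [NormedAddCommGroup E] [NormedSpace ℝ E] [FiniteDimensional ℝ E]
  {H : Type*} [TopologicalSpace H] {I : ModelWithCorners ℝ E H}
  {M : Type*} [TopologicalSpace M] [ChartedSpace H M] [IsManifold I ∞ M]
  (g : Metric I M) {x₀ x : M}

variable (I) in
/-- The domain of the trivialization of the tangent bundle around `x₀`. -/
abbrev frameDomain (x₀ : M) : Set M :=
  (trivializationAt E (fun y : M => TangentSpace I y) x₀).baseSet

variable (I) in
/-- The coordinate frame around `x₀`: a smooth local frame of the tangent bundle on
`frameDomain I x₀`, equal to zero elsewhere. -/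
noncomputable def frame (x₀ : M) : Fin (finrank ℝ E) → VField I M :=
  (trivializationAt E (fun y : M => TangentSpace I y) x₀).localFrame (finBasis ℝ E)

/-- The coordinate frame around `x₀`, as a basis of the tangent space at a point. -/
noncomputable def frameBasis (hx : x ∈ frameDomain I x₀) :
    Basis (Fin (finrank ℝ E)) ℝ (TangentSpace I x) :=
  (trivializationAt E (fun y : M => TangentSpace I y) x₀).basisAt (finBasis ℝ E) hx

theorem frameBasis_apply (hx : x ∈ frameDomain I x₀) (i : Fin (finrank ℝ E)) :
    frameBasis hx i = frame I x₀ i x :=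
  (Trivialization.localFrame_apply_of_mem_baseSet _ _ hx).symm

omit [FiniteDimensional ℝ E] in
theorem self_mem_frameDomain (x : M) : x ∈ frameDomain I x :=
  FiberBundle.mem_baseSet_trivializationAt E _ x

omit [FiniteDimensional ℝ E] in
theorem frameDomain_mem_nhds (x : M) : frameDomain I x ∈ nhds x :=
  (trivializationAt E (fun y : M => TangentSpace I y) x).open_baseSet.mem_nhds
    (self_mem_frameDomain x)

theorem contMDiffAt_frame (hx : x ∈ frameDomain I x₀) (i : Fin (finrank ℝ E)) :
    CMDiffAt ∞ (T% (frame I x₀ i)) x :=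
  contMDiffAt_localFrame_of_mem ∞ _ (finBasis ℝ E) i hx

theorem mdifferentiableAt_frame (hx : x ∈ frameDomain I x₀) (i : Fin (finrank ℝ E)) :
    MDiffAt (T% (frame I x₀ i)) x :=
  (contMDiffAt_frame hx i).mdifferentiableAt (by simp)

/-- The Gram matrix of the metric in the coordinate frame around `x₀`. -/
noncomputable def gram (x₀ x : M) : Matrix (Fin (finrank ℝ E)) (Fin (finrank ℝ E)) ℝ :=
  Matrix.of fun i j => g.inner x (frame I x₀ i x) (frame I x₀ j x)

/-- The metric at a point as an algebraic bilinear form. -/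
noncomputable def bilin (x : M) : TangentSpace I x →ₗ[ℝ] TangentSpace I x →ₗ[ℝ] ℝ :=
  (g.inner x).toLinearMap₁₂

omit [FiniteDimensional ℝ E] in
@[simp]
theorem bilin_apply (v w : TangentSpace I x) : bilin g x v w = g.inner x v w := rfl

theorem gram_eq (hx : x ∈ frameDomain I x₀) :
    gram g x₀ x = Matrix.of fun i j => bilin g x (frameBasis hx i) (frameBasis hx j) := by
  simp only [frameBasis_apply]
  rfl

theorem gram_det_pos (hx : x ∈ frameDomain I x₀) : 0 < (gram g x₀ x).det := by
  rw [gram_eq g hx]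
  exact det_gram_pos _ (g.symm x) (g.pos x) _

theorem gram_inv_symm (i j : Fin (finrank ℝ E)) : (gram g x₀ x)⁻¹ i j = (gram g x₀ x)⁻¹ j i := by
  have h : (gram g x₀ x).transpose = gram g x₀ x := by
    ext i j
    exact g.symm x _ _
  have h2 := Matrix.transpose_nonsing_inv (gram g x₀ x)
  rw [h] at h2
  exact congrFun (congrFun h2 j) i

theorem sum_gram_inv_mul_inner (hx : x ∈ frameDomain I x₀) (w : TangentSpace I x)
    (i : Fin (finrank ℝ E)) :
    ∑ j, (gram g x₀ x)⁻¹ j i * g.inner x w (frame I x₀ j x) = (frameBasis hx).repr w i := by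
  rw [← sum_inv_gram_mul (bilin g x) (frameBasis hx)
    (by rw [← gram_eq]; exact (gram_det_pos g hx).ne'), ← gram_eq]
  simp [frameBasis_apply]

theorem trace_eq_sum_gram_inv (hx : x ∈ frameDomain I x₀)
    (L : TangentSpace I x →ₗ[ℝ] TangentSpace I x) :
    LinearMap.trace ℝ (TangentSpace I x) L =
      ∑ i, ∑ j, (gram g x₀ x)⁻¹ j i * g.inner x (L (frame I x₀ i x)) (frame I x₀ j x) := by
  rw [LinearMap.trace_eq_matrix_trace ℝ (frameBasis hx), Matrix.trace]
  refine Finset.sum_congr rfl fun i _ => ?_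
  rw [sum_gram_inv_mul_inner g hx, Matrix.diag_apply, LinearMap.toMatrix_apply, frameBasis_apply]

theorem contMDiffAt_gram (hx : x ∈ frameDomain I x₀) (i j : Fin (finrank ℝ E)) :
    ContMDiffAt I 𝓘(ℝ, ℝ) ∞ (fun y => gram g x₀ y i j) x :=
  contMDiffAt_inner g (contMDiffAt_frame hx i) (contMDiffAt_frame hx j)

theorem contMDiffAt_gram_inv (hx : x ∈ frameDomain I x₀) (i j : Fin (finrank ℝ E)) :
    ContMDiffAt I 𝓘(ℝ, ℝ) ∞ (fun y => (gram g x₀ y)⁻¹ i j) x :=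
  contMDiffAt_matrix_inv (contMDiffAt_gram g hx) (gram_det_pos g hx).ne' i j

/-- A vector field is smooth as soon as its inner products with a smooth frame are. -/
theorem contMDiffAt_of_inner_frame {V : VField I M}
    (h : ∀ j, ContMDiffAt I 𝓘(ℝ, ℝ) ∞ (fun y => g.inner y (V y) (frame I x j y)) x) :
    CMDiffAt ∞ (T% V) x := by
  have hx := self_mem_frameDomain (I := I) x
  rw [contMDiffAt_iff_localFrameCoeff (I := I) (finBasis ℝ E) hx]
  intro i
  have hs : ContMDiffAt I 𝓘(ℝ, ℝ) ∞
      (fun y => ∑ j, (gram g x y)⁻¹ j i * g.inner y (V y) (frame I x j y)) x :=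
    contMDiffAt_finsetSum fun j _ => (contMDiffAt_gram_inv g hx j i).mul (h j)
  refine hs.congr_of_eventuallyEq ?_
  filter_upwards [frameDomain_mem_nhds (I := I) x] with y hy
  rw [sum_gram_inv_mul_inner g hy]
  exact Trivialization.localFrameCoeff_apply_of_mem_baseSet _ _ hy _ _

theorem divergence_eq_sum_koszul (hx : x ∈ frameDomain I x₀) {X : VField I M}
    (hX : MDiffAt (T% X) x) :
    divergence g X x = ∑ i, ∑ j, (gram g x₀ x)⁻¹ j i *
      koszul g (frame I x₀ i) X (frame I x₀ j) x := by
  rw [divergence, trace_eq_sum_gram_inv g hx]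
  refine Finset.sum_congr rfl fun i _ => Finset.sum_congr rfl fun j _ => ?_
  rw [← inner_leviCivita g (mdifferentiableAt_frame hx i) hX (mdifferentiableAt_frame hx j)]
  rfl

omit [FiniteDimensional ℝ E] in
/-- Symmetrized in its outer arguments, Koszul's expression retains the derivative of the metric only
along the middle argument. -/
theorem koszul_add_koszul_swap (A X B : VField I M) :
    koszul g A X B x + koszul g B X A x =
      mvfderiv I (fun y => g.inner y (A y) (B y)) x (X x)
        + g.inner x (VectorField.mlieBracket I A X x) (B x)
        + g.inner x (VectorField.mlieBracket I B X x) (A x) := by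
  have e1 : (fun y => g.inner y (B y) (A y)) = fun y => g.inner y (A y) (B y) :=
    funext fun y => g.symm _ _ _
  have e2 : (fun y => g.inner y (B y) (X y)) = fun y => g.inner y (X y) (B y) :=
    funext fun y => g.symm _ _ _
  have e3 : (fun y => g.inner y (A y) (X y)) = fun y => g.inner y (X y) (A y) :=
    funext fun y => g.symm _ _ _
  simp only [koszul, e1, e2, e3]
  rw [VectorField.mlieBracket_swap_apply (V := X) (W := B),
    VectorField.mlieBracket_swap_apply (V := X) (W := A),
    VectorField.mlieBracket_swap_apply (V := B) (W := A)]
  simp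
  ring

/-- The divergence in a local frame. The first sum does not involve the metric, so that the metric
enters only through the logarithmic derivative of its determinant. -/
theorem divergence_eq_sum_mlieBracket (hx : x ∈ frameDomain I x₀) {X : VField I M}
    (hX : MDiffAt (T% X) x) :
    divergence g X x =
      ∑ i, (frameBasis hx).repr (VectorField.mlieBracket I (frame I x₀ i) X x) i
        + ((gram g x₀ x).det)⁻¹ * mvfderiv I (fun y => (gram g x₀ y).det) x (X x) / 2 := by
  -- The inverse Gram matrix is symmetric, so only the symmetrization of Koszul's expression counts.
  have hswap : ∀ F : Fin (finrank ℝ E) → Fin (finrank ℝ E) → ℝ,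
      ∑ i, ∑ j, (gram g x₀ x)⁻¹ j i * F j i = ∑ i, ∑ j, (gram g x₀ x)⁻¹ j i * F i j := by
    intro F
    rw [Finset.sum_comm]
    refine Finset.sum_congr rfl fun i _ => Finset.sum_congr rfl fun j _ => ?_
    rw [gram_inv_symm]
  have h2 : 2 * divergence g X x = ∑ i, ∑ j, (gram g x₀ x)⁻¹ j i *
      (koszul g (frame I x₀ i) X (frame I x₀ j) x
        + koszul g (frame I x₀ j) X (frame I x₀ i) x) := by
    simp_rw [mul_add, Finset.sum_add_distrib]
    rw [hswap fun i j => koszul g (frame I x₀ i) X (frame I x₀ j) x,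
      ← divergence_eq_sum_koszul g hx hX, two_mul]
  have h3 := hswap fun i j =>
    g.inner x (VectorField.mlieBracket I (frame I x₀ i) X x) (frame I x₀ j x)
  have h4 := sum_inv_mul_mvfderiv (A := gram g x₀) (fun i j =>
    (contMDiffAt_gram g hx i j).mdifferentiableAt (by simp)) (X x)
  simp_rw [koszul_add_koszul_swap, mul_add, Finset.sum_add_distrib] at h2
  rw [h3] at h2
  simp_rw [sum_gram_inv_mul_inner g hx] at h2
  rw [← h4]
  have h5 : (∑ i, ∑ j, (gram g x₀ x)⁻¹ j i *
      mvfderiv I (fun y => g.inner y (frame I x₀ i y) (frame I x₀ j y)) x (X x)) =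
      ∑ i, ∑ j, (gram g x₀ x)⁻¹ j i * mvfderiv I (fun y => gram g x₀ y i j) x (X x) := rfl
  rw [h5] at h2
  linarith

end Frame

/-! ### The metric `g (C⁻¹ u, v)` -/

section ChangeOfMetric

variable {E : Type*} [NormedAddCommGroup E] [NormedSpace ℝ E] [FiniteDimensional ℝ E]
  {H : Type*} [TopologicalSpace H] {I : ModelWithCorners ℝ E H}
  {M : Type*} [TopologicalSpace M] [ChartedSpace H M] [IsManifold I ∞ M]
  {g g' : Metric I M} {C : Tensor11 I M} {x : M}

theorem IsSymmPosDef.isInvertible (hpos : IsSymmPosDef g C) (x : M) : (C x).IsInvertible := by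
  have hinj : Function.Injective (C x).toLinearMap := by
    rw [injective_iff_map_eq_zero]
    intro v hv
    by_contra hne
    have h := hpos.pos x v hne
    have hv' : C x v = 0 := hv
    simp [hv'] at h
  exact ⟨(LinearEquiv.ofInjectiveEndo _ hinj).toContinuousLinearEquiv, by ext v; rfl⟩

/-- The inverse square root of a positive definite tensor at a point, characterized by
`C S² = 1`. -/
theorem IsSymmPosDef.invSqrt_spec (hpos : IsSymmPosDef g C) (x : M) :
    (∀ v w, g.inner x (invSqrt (C x).toLinearMap v) w =
      g.inner x v (invSqrt (C x).toLinearMap w)) ∧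
    ∀ v, C x (invSqrt (C x).toLinearMap (invSqrt (C x).toLinearMap v)) = v := by
  obtain ⟨h1, -, h3⟩ := RiemannianOps.invSqrt_spec (bilin g x) (g.symm x) (g.pos x)
    (C x).toLinearMap (hpos.symm x) (hpos.pos x)
  exact ⟨h1, h3⟩

theorem IsSymmPosDef.inner_inverse (hpos : IsSymmPosDef g C) (x : M) (u v : TangentSpace I x) :
    g.inner x ((C x).inverse u) v =
      g.inner x (invSqrt (C x).toLinearMap u) (invSqrt (C x).toLinearMap v) := by
  obtain ⟨hsymm, hsq⟩ := hpos.invSqrt_spec x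
  rw [← hsymm]
  congr 2
  conv_lhs => rw [← hsq u]
  exact (hpos.isInvertible x).inverse_apply_self _

/-- The metric `g (C⁻¹ u, v)`, which is the metric `C^{-1/2} g C^{-1/2}`. -/
noncomputable def changedMetric (hC : SmoothTensor11 C) (hpos : IsSymmPosDef g C) : Metric I M where
  inner x := g.inner x ∘L (C x).inverse
  symm x u v := by
    simp only [ContinuousLinearMap.comp_apply, hpos.inner_inverse]
    exact g.symm x _ _
  pos x v hv := by
    simp only [ContinuousLinearMap.comp_apply, hpos.inner_inverse]
    refine g.pos x _ fun h => hv ?_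
    rw [← (hpos.invSqrt_spec x).2 v, h]
    simp
  isVonNBounded x := by
    let S := LinearMap.toContinuousLinearMap (invSqrt (C x).toLinearMap)
    refine ((g.isVonNBounded x).image (C x ∘L S)).subset fun v hv => ?_
    refine ⟨S v, ?_, (hpos.invSqrt_spec x).2 v⟩
    have hv' : g.inner x ((C x).inverse v) v < 1 := hv
    rwa [hpos.inner_inverse] at hv'
  contMDiff x := contMDiffAt_clm_bundle_comp g.contMDiff.contMDiffAt
    (contMDiffAt_clm_bundle_inverse hpos.isInvertible hC.contMDiffAt)

theorem isChangeOfMetric_changedMetric (hC : SmoothTensor11 C) (hpos : IsSymmPosDef g C) :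
    IsChangeOfMetric g C (changedMetric hC hpos) :=
  fun x u v => hpos.inner_inverse x u v

theorem changedMetric_inner_apply (hC : SmoothTensor11 C) (hpos : IsSymmPosDef g C) (x : M)
    (v w : TangentSpace I x) : (changedMetric hC hpos).inner x (C x v) w = g.inner x v w := by
  change g.inner x ((C x).inverse (C x v)) w = _
  rw [(hpos.isInvertible x).inverse_apply_self]

theorem grad_eq_of_inner (h : ∀ x v w, g'.inner x (C x v) w = g.inner x v w) (f : M → ℝ) (x : M) :
    grad g' f x = C x (grad g f x) := by
  refine inner_left_cancel g' fun w => ?_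
  rw [h, grad, grad, inner_sharp, inner_sharp]

omit [FiniteDimensional ℝ E] in
theorem metricDet_eq_of_inner (h : ∀ x v w, g'.inner x (C x v) w = g.inner x v w)
    {ι : Type*} [Fintype ι] [DecidableEq ι] (e : Basis ι ℝ (TangentSpace I x)) :
    metricDet g x e = LinearMap.det (C x).toLinearMap * metricDet g' x e :=
  det_gram_comp (bilin g x) (bilin g' x) (C x).toLinearMap (h x) e

omit [FiniteDimensional ℝ E] in
theorem metricDet_pos (g : Metric I M) {ι : Type*} [Fintype ι] [DecidableEq ι]
    (e : Basis ι ℝ (TangentSpace I x)) : 0 < metricDet g x e :=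
  det_gram_pos (bilin g x) (g.symm x) (g.pos x) e

omit [FiniteDimensional ℝ E] in
theorem sqrtDet_eq_of_inner (h : ∀ x v w, g'.inner x (C x v) w = g.inner x v w)
    {ι : Type*} [Fintype ι] [DecidableEq ι] (e : Basis ι ℝ (TangentSpace I x)) :
    Real.sqrt (metricDet g x e / metricDet g' x e) = sqrtDet C x := by
  rw [metricDet_eq_of_inner h e, mul_div_cancel_right₀ _ (metricDet_pos g' e).ne', sqrtDet]

theorem gram_det_eq_of_inner (h : ∀ x v w, g'.inner x (C x v) w = g.inner x v w) {x₀ : M}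
    (hx : x ∈ frameDomain I x₀) :
    (gram g x₀ x).det = LinearMap.det (C x).toLinearMap * (gram g' x₀ x).det := by
  rw [gram_eq g hx, gram_eq g' hx]
  exact det_gram_comp (bilin g x) (bilin g' x) (C x).toLinearMap (h x) _

theorem det_pos_of_inner (h : ∀ x v w, g'.inner x (C x v) w = g.inner x v w) (x : M) :
    0 < LinearMap.det (C x).toLinearMap := by
  have hx := self_mem_frameDomain (I := I) x
  have h1 := gram_det_pos g hx
  rw [gram_det_eq_of_inner h hx] at h1
  exact pos_of_mul_pos_left h1 (gram_det_pos g' hx).le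

theorem sqrtDet_pos_of_inner (h : ∀ x v w, g'.inner x (C x v) w = g.inner x v w) (x : M) :
    0 < sqrtDet C x :=
  Real.sqrt_pos.2 (det_pos_of_inner h x)

theorem contMDiffAt_sqrtDet_of_inner (h : ∀ x v w, g'.inner x (C x v) w = g.inner x v w) (x : M) :
    ContMDiffAt I 𝓘(ℝ, ℝ) ∞ (sqrtDet C) x := by
  have hx := self_mem_frameDomain (I := I) x
  have hdet : ∀ y ∈ frameDomain I x,
      LinearMap.det (C y).toLinearMap = (gram g x y).det * ((gram g' x y).det)⁻¹ := fun y hy => by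
    rw [gram_det_eq_of_inner h hy, mul_inv_cancel_right₀ (gram_det_pos g' hy).ne']
  have h1 : ContMDiffAt I 𝓘(ℝ, ℝ) ∞
      (fun y => (gram g x y).det * ((gram g' x y).det)⁻¹) x :=
    (contMDiffAt_det (contMDiffAt_gram g hx)).mul
      ((contMDiffAt_det (contMDiffAt_gram g' hx)).inv₀ (gram_det_pos g' hx).ne')
  have h2 : ContDiffAt ℝ ∞ Real.sqrt ((gram g x x).det * ((gram g' x x).det)⁻¹) :=
    Real.contDiffAt_sqrt (by rw [← hdet x hx]; exact (det_pos_of_inner h x).ne')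
  refine (h2.contMDiffAt.comp x h1).congr_of_eventuallyEq ?_
  filter_upwards [frameDomain_mem_nhds (I := I) x] with y hy
  simp [sqrtDet, hdet y hy]

omit [FiniteDimensional ℝ E] [IsManifold I ∞ M] in
theorem mvfderiv_congr {f₁ f₂ : M → ℝ} (h : f₁ =ᶠ[nhds x] f₂) (v : TangentSpace I x) :
    mvfderiv I f₁ x v = mvfderiv I f₂ x v := by
  change mfderiv I 𝓘(ℝ, ℝ) f₁ x v = mfderiv I 𝓘(ℝ, ℝ) f₂ x v
  rw [h.mfderiv_eq]
  rfl

/-- The volume densities of `g` and `g'` differ by the factor `ρ = √|C|`, so the divergences differ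
by the logarithmic derivative of `ρ`. -/
theorem divergence_of_inner (h : ∀ x v w, g'.inner x (C x v) w = g.inner x v w) {X : VField I M}
    (hX : MDiffAt (T% X) x) :
    divergence g' X x =
      divergence g X x - (sqrtDet C x)⁻¹ * mvfderiv I (sqrtDet C) x (X x) := by
  have hx := self_mem_frameDomain (I := I) x
  have hρ : MDifferentiableAt I 𝓘(ℝ, ℝ) (sqrtDet C) x :=
    (contMDiffAt_sqrtDet_of_inner h x).mdifferentiableAt (by simp)
  have hρρ : MDifferentiableAt I 𝓘(ℝ, ℝ) (fun y => sqrtDet C y * sqrtDet C y) x := hρ.mul hρ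
  have hG' : MDifferentiableAt I 𝓘(ℝ, ℝ) (fun y => (gram g' x y).det) x :=
    (contMDiffAt_det (contMDiffAt_gram g' hx)).mdifferentiableAt (by simp)
  have hdet : ∀ y ∈ frameDomain I x,
      (gram g x y).det = sqrtDet C y * sqrtDet C y * (gram g' x y).det := fun y hy => by
    rw [gram_det_eq_of_inner h hy, sqrtDet, Real.mul_self_sqrt (det_pos_of_inner h y).le]
  have hd : mvfderiv I (fun y => (gram g x y).det) x (X x) =
      sqrtDet C x * sqrtDet C x * mvfderiv I (fun y => (gram g' x y).det) x (X x)
        + (gram g' x x).det * (2 * sqrtDet C x * mvfderiv I (sqrtDet C) x (X x)) := by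
    rw [mvfderiv_congr (f₂ := fun y => sqrtDet C y * sqrtDet C y * (gram g' x y).det)
      (Filter.eventually_of_mem (frameDomain_mem_nhds x) hdet),
      mvfderiv_fun_mul hρρ hG', mvfderiv_fun_mul hρ hρ]
    simp
    ring
  have hρ0 := (sqrtDet_pos_of_inner h x).ne'
  have hG0 := (gram_det_pos g' hx).ne'
  rw [divergence_eq_sum_mlieBracket g' hx hX, divergence_eq_sum_mlieBracket g hx hX, hd,
    hdet x hx]
  field_simp
  ring

end ChangeOfMetric

/-! ### The divergence of a tensor field -/

section TensorDivergence

variable {E : Type*} [NormedAddCommGroup E] [NormedSpace ℝ E] [FiniteDimensional ℝ E]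
  {H : Type*} [TopologicalSpace H] {I : ModelWithCorners ℝ E H}
  {M : Type*} [TopologicalSpace M] [ChartedSpace H M] [IsManifold I ∞ M]
  (g : Metric I M) {T C : Tensor11 I M} {x : M} {f : M → ℝ}

omit [FiniteDimensional ℝ E] in
theorem mdifferentiableAt_tensor_apply (hT : SmoothTensor11 T) {X : VField I M}
    (hX : MDiffAt (T% X) x) : MDiffAt (T% (fun y => T y (X y))) x :=
  MDifferentiableAt.clm_bundle_apply (F₁ := E) (F₂ := E) (E₁ := fun y : M => TangentSpace I y)
    (E₂ := fun y : M => TangentSpace I y) (hT.contMDiffAt.mdifferentiableAt (by simp)) hX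

/-- The divergence of `T Y` minus the contraction of `T` with `∇Y` is tensorial in `Y`. -/
theorem tensorialAt_divergence_sub_trace
    (hT : ∀ Y : VField I M, MDiffAt (T% Y) x → MDiffAt (T% (fun y => T y (Y y))) x) :
    TensorialAt I E (fun Y : VField I M => divergence g (fun y => T y (Y y)) x
      - LinearMap.trace ℝ (TangentSpace I x) (T x ∘L leviCivita g Y x).toLinearMap) x where
  smul {f Y} hf hY := by
    have h1 := divergence_smul g hf (hT Y hY)
    have h2 : (fun y => T y ((f • Y) y)) = fun y => f y • T y (Y y) :=
      funext fun y => map_smul (T y) (f y) (Y y)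
    have h3 : (T x ∘L leviCivita g (f • Y) x).toLinearMap =
        f x • (T x ∘L leviCivita g Y x).toLinearMap +
          (mvfderiv I f x).toLinearMap.smulRight (T x (Y x)) := by
      ext v
      refine (congrArg (fun L => T x (L v)) (leviCivita_smul g hf hY)).trans ?_
      simp
    rw [h2, h1, h3, map_add, map_smul, LinearMap.trace_smulRight]
    simp
    ring
  add {Y Z} hY hZ := by
    have h1 := divergence_add g (hT Y hY) (hT Z hZ)
    have h2 : (fun y => T y ((Y + Z) y)) = fun y => T y (Y y) + T y (Z y) :=
      funext fun y => map_add (T y) (Y y) (Z y)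
    have h3 : (T x ∘L leviCivita g (Y + Z) x).toLinearMap =
        (T x ∘L leviCivita g Y x).toLinearMap + (T x ∘L leviCivita g Z x).toLinearMap := by
      ext v
      refine (congrArg (fun L => T x (L v)) (leviCivita_add g hY hZ)).trans ?_
      simp
    rw [h2, h1, h3, map_add]
    ring

/-- The Leibniz rule `div (T Y) = tr (T ∇Y) + g (div T, Y)`. -/
theorem inner_divTensor
    (hT : ∀ Y : VField I M, MDiffAt (T% Y) x → MDiffAt (T% (fun y => T y (Y y))) x)
    {Y : VField I M} (hY : MDiffAt (T% Y) x) :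
    g.inner x (divTensor g T x) (Y x) = divergence g (fun y => T y (Y y)) x
      - LinearMap.trace ℝ (TangentSpace I x) (T x ∘L leviCivita g Y x).toLinearMap := by
  have hΦ := tensorialAt_divergence_sub_trace g hT
  rw [← TensorialAt.mkHom_apply hΦ hY, divTensor, inner_sharp]
  congr 1
  apply ContinuousLinearMap.coe_injective
  refine (tbasis x).ext fun k => ?_
  change (tbasis x).constr ℝ _ (tbasis x k) = TensorialAt.mkHom _ x hΦ (tbasis x k)
  rw [Basis.constr_basis, TensorialAt.mkHom_apply_eq_extend]
  simp only [covTensor, divergence, ContinuousLinearMap.toLinearMap_sub, map_sub]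
  rfl

/-- The Leibniz rule `div (f C) = f div C + C ∇f` for a symmetric tensor `C`. -/
theorem divTensor_smul (hsymm : ∀ v w, g.inner x (C x v) w = g.inner x v (C x w))
    (hC : SmoothTensor11 C) (hf : MDifferentiableAt I 𝓘(ℝ, ℝ) f x) :
    divTensor g (fun y => f y • C y) x = f x • divTensor g C x + C x (grad g f x) := by
  have hC' : ∀ Y : VField I M, MDiffAt (T% Y) x → MDiffAt (T% (fun y => C y (Y y))) x :=
    fun Y hY => mdifferentiableAt_tensor_apply hC hY
  have hfC : ∀ Y : VField I M, MDiffAt (T% Y) x →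
      MDiffAt (T% (fun y => (f y • C y) (Y y))) x :=
    fun Y hY => hf.smul_section (hC' Y hY)
  refine inner_left_cancel g fun w => ?_
  have hw := mdifferentiableAt_extendVec (I := I) w
  have h1 := inner_divTensor g hfC hw
  have h2 := inner_divTensor g hC' hw
  have h3 := divergence_smul g hf (hC' _ hw)
  have h4 : ((f x • C x) ∘L leviCivita g (extendVec w) x).toLinearMap =
      f x • (C x ∘L leviCivita g (extendVec w) x).toLinearMap := rfl
  rw [h4, map_smul] at h1
  simp only [_root_.smul_apply] at h1
  rw [h3] at h1
  simp only [extendVec_self] at h1 h2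
  rw [h1, map_add, map_smul, _root_.add_apply, _root_.smul_apply, h2, hsymm, grad, inner_sharp]
  simp
  ring

theorem contMDiffAt_grad (hf : ContMDiffAt I 𝓘(ℝ, ℝ) ∞ f x) : CMDiffAt ∞ (T% (grad g f)) x := by
  refine contMDiffAt_of_inner_frame g fun j => ?_
  simp only [grad, inner_sharp]
  exact contMDiffAt_mvfderiv_apply hf (contMDiffAt_frame (self_mem_frameDomain x) j)

theorem contMDiffAt_divTensor (hC : SmoothTensor11 C)
    (hsymm : ∀ x v w, g.inner x (C x v) w = g.inner x v (C x w)) :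
    CMDiffAt ∞ (T% (divTensor g C)) x := by
  have hx := self_mem_frameDomain (I := I) x
  refine contMDiffAt_of_inner_frame g fun k => ?_
  have hs : ContMDiffAt I 𝓘(ℝ, ℝ) ∞ (fun y => ∑ i, ∑ j, (gram g x y)⁻¹ j i *
      (koszul g (frame I x i) (fun z => C z (frame I x k z)) (frame I x j) y -
        koszul g (frame I x i) (frame I x k) (fun z => C z (frame I x j z)) y)) x :=
    contMDiffAt_finsetSum fun i _ => contMDiffAt_finsetSum fun j _ =>
      (contMDiffAt_gram_inv g hx j i).mul
        ((contMDiffAt_koszul g (contMDiffAt_frame hx i)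
          (contMDiffAt_tensor_apply hC (contMDiffAt_frame hx k)) (contMDiffAt_frame hx j)).sub
        (contMDiffAt_koszul g (contMDiffAt_frame hx i) (contMDiffAt_frame hx k)
          (contMDiffAt_tensor_apply hC (contMDiffAt_frame hx j))))
  refine hs.congr_of_eventuallyEq ?_
  filter_upwards [frameDomain_mem_nhds (I := I) x] with y hy
  have hE := mdifferentiableAt_frame (I := I) hy
  rw [inner_divTensor g (fun Y hY => mdifferentiableAt_tensor_apply hC hY) (hE k),
    divergence_eq_sum_koszul g hy (mdifferentiableAt_tensor_apply hC (hE k)),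
    trace_eq_sum_gram_inv g hy]
  simp_rw [mul_sub, Finset.sum_sub_distrib]
  congr 1
  refine Finset.sum_congr rfl fun i _ => Finset.sum_congr rfl fun j _ => ?_
  rw [← inner_leviCivita g (hE i) (hE k) (mdifferentiableAt_tensor_apply hC (hE j)), ← hsymm]
  rfl

/-- In an orthonormal basis, the full contraction of `C` with the Hessian is the trace of `C ∇∇f`. -/
theorem sum_components_mul_hessian (hsymm : ∀ v w, g.inner x (C x v) w = g.inner x v (C x w))
    {ι : Type*} [Fintype ι] [DecidableEq ι] (e : Basis ι ℝ (TangentSpace I x))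
    (he : IsOrthonormal g x e) :
    ∑ i, ∑ j, components g C x e i j * hessian g f x (e i) (e j) =
      LinearMap.trace ℝ (TangentSpace I x) (C x ∘L leviCivita g (grad g f) x).toLinearMap := by
  have hrepr : ∀ v i, e.repr v i = g.inner x v (e i) := fun v i => by
    conv_rhs => rw [← e.sum_repr v]
    have he' : ∀ i j, g.inner x (e i) (e j) = if i = j then 1 else 0 := he
    rw [map_sum, _root_.sum_apply]
    simp [he']
  rw [LinearMap.trace_eq_matrix_trace ℝ e, Matrix.trace]
  refine Finset.sum_congr rfl fun i _ => ?_
  rw [Matrix.diag_apply, LinearMap.toMatrix_apply, hrepr]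
  change _ = g.inner x (C x (leviCivita g (grad g f) x (e i))) (e i)
  rw [hsymm]
  conv_rhs => rw [← e.sum_repr (C x (e i))]
  rw [map_sum]
  refine Finset.sum_congr rfl fun j _ => ?_
  rw [map_smul, smul_eq_mul, hrepr, components, hessian, g.symm x (e i), hsymm, g.symm x (e j),
    hsymm]

end TensorDivergence

/-! ### The drift field and the two identities -/

section DriftField

variable {E : Type*} [NormedAddCommGroup E] [NormedSpace ℝ E] [FiniteDimensional ℝ E]
  {H : Type*} [TopologicalSpace H] {I : ModelWithCorners ℝ E H}
  {M : Type*} [TopologicalSpace M] [ChartedSpace H M] [IsManifold I ∞ M]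
  {g g' : Metric I M} {C : Tensor11 I M} {f : M → ℝ} {x : M}

variable (g C) in
/-- The vector field `κ = C ∇(log ρ) - div C`, where `ρ = √|C|`. -/
noncomputable def drift : VField I M := fun x =>
  (sqrtDet C x)⁻¹ • C x (grad g (sqrtDet C) x) - divTensor g C x

theorem smoothVField_drift (h : ∀ x v w, g'.inner x (C x v) w = g.inner x v w)
    (hC : SmoothTensor11 C) (hpos : IsSymmPosDef g C) : SmoothVField (drift g C) := fun x =>
  ContMDiffAt.sub_section
    (((contMDiffAt_sqrtDet_of_inner h x).inv₀ (sqrtDet_pos_of_inner h x).ne').smul_section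
      (contMDiffAt_tensor_apply hC (contMDiffAt_grad g (contMDiffAt_sqrtDet_of_inner h x))))
    (contMDiffAt_divTensor g hC hpos.symm)

/-- The first identity: `Δ' f = div (C ∇f) - g (C ∇(log ρ), ∇f)`, in which the Leibniz rule for
`div (C ∇f)` isolates the second-order part `tr (C ∇∇f)`. -/
theorem trace_hessian_eq (h : ∀ x v w, g'.inner x (C x v) w = g.inner x v w)
    (hC : SmoothTensor11 C) (hpos : IsSymmPosDef g C) (hf : ContMDiffAt I 𝓘(ℝ, ℝ) ∞ f x) :
    LinearMap.trace ℝ (TangentSpace I x) (C x ∘L leviCivita g (grad g f) x).toLinearMap =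
      laplacian g' f x + g.inner x (drift g C x) (grad g f x) := by
  have hdf : MDiffAt (T% (grad g f)) x := (contMDiffAt_grad g hf).mdifferentiableAt (by simp)
  have h1 := inner_divTensor g (fun Y hY => mdifferentiableAt_tensor_apply hC hY) hdf
  have h2 := divergence_of_inner h (mdifferentiableAt_tensor_apply hC hdf)
  have h3 : g.inner x (C x (grad g (sqrtDet C) x)) (grad g f x) =
      mvfderiv I (sqrtDet C) x (C x (grad g f x)) := by
    rw [hpos.symm, grad, inner_sharp]
  have h4 : grad g' f = fun y => C y (grad g f y) := funext fun y => grad_eq_of_inner h f y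
  rw [laplacian, h4, h2, drift, map_sub, _root_.sub_apply, map_smul, _root_.smul_apply, h1, h3]
  simp

/-- Weighting by `ρ` turns the divergence of `g'` into that of `g`: `div' (ρ Z) = ρ div Z`. -/
theorem divergence_smul_sqrtDet (h : ∀ x v w, g'.inner x (C x v) w = g.inner x v w)
    {Z : VField I M} (hZ : MDiffAt (T% Z) x) :
    divergence g' (fun y => sqrtDet C y • Z y) x = sqrtDet C x * divergence g Z x := by
  have hρ : MDifferentiableAt I 𝓘(ℝ, ℝ) (sqrtDet C) x :=
    (contMDiffAt_sqrtDet_of_inner h x).mdifferentiableAt (by simp)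
  have hρZ : MDiffAt (T% (fun y => sqrtDet C y • Z y)) x := hρ.smul_section hZ
  rw [divergence_of_inner h hρZ, divergence_smul g hρ hZ, map_smul, smul_eq_mul,
    inv_mul_cancel_left₀ (sqrtDet_pos_of_inner h x).ne']
  ring

/-- The second identity: both sides are the divergence of `C ∇f + f div C`. -/
theorem divDiv_smul_eq (h : ∀ x v w, g'.inner x (C x v) w = g.inner x v w)
    (hC : SmoothTensor11 C) (hpos : IsSymmPosDef g C) (hf : ContMDiff I 𝓘(ℝ, ℝ) ∞ f) (x : M) :
    divDiv g (fun y => f y • C y) x =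
      (sqrtDet C x)⁻¹ * laplacian g' (fun y => sqrtDet C y * f y) x
        - divergence g (fun y => f y • drift g C y) x := by
  have hρ0 : ∀ y, sqrtDet C y ≠ 0 := fun y => (sqrtDet_pos_of_inner h y).ne'
  have hρ : ∀ y, MDifferentiableAt I 𝓘(ℝ, ℝ) (sqrtDet C) y := fun y =>
    (contMDiffAt_sqrtDet_of_inner h y).mdifferentiableAt (by simp)
  have hfd : ∀ y, MDifferentiableAt I 𝓘(ℝ, ℝ) f y := fun y => hf.mdifferentiableAt (by simp)
  let Z : VField I M := fun y =>
    C y (grad g f y) + f y • ((sqrtDet C y)⁻¹ • C y (grad g (sqrtDet C) y))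
  -- `∇' (ρ f) = ρ (C ∇f + f C ∇(log ρ))`
  have hgrad : grad g' (fun y => sqrtDet C y * f y) = fun y => sqrtDet C y • Z y := by
    funext y
    rw [grad_eq_of_inner h]
    have hprod : grad g (fun y => sqrtDet C y * f y) y =
        sqrtDet C y • grad g f y + f y • grad g (sqrtDet C) y := by
      refine inner_left_cancel g fun w => ?_
      rw [grad, inner_sharp, mvfderiv_fun_mul (hρ y) (hfd y)]
      simp [grad, inner_sharp]
    rw [hprod]
    simp only [Z, map_add, map_smul, smul_add, smul_smul]
    congr 2
    field_simp [hρ0 y]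
  have hCf : MDiffAt (T% (fun y => C y (grad g f y))) x := mdifferentiableAt_tensor_apply hC
    ((contMDiffAt_grad g hf.contMDiffAt).mdifferentiableAt (by simp))
  have hCρ : MDiffAt (T% (fun y => (sqrtDet C y)⁻¹ • C y (grad g (sqrtDet C) y))) x :=
    MDifferentiableAt.smul_section
      (((contMDiffAt_sqrtDet_of_inner h x).inv₀ (hρ0 x)).mdifferentiableAt (by simp))
      (mdifferentiableAt_tensor_apply hC
        ((contMDiffAt_grad g (contMDiffAt_sqrtDet_of_inner h x)).mdifferentiableAt (by simp)))
  have hZ : MDiffAt (T% Z) x := mdifferentiableAt_add_section hCf ((hfd x).smul_section hCρ)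
  have hdiv : MDiffAt (T% (divTensor g (fun y => f y • C y))) x := by
    have heq : divTensor g (fun y => f y • C y) =
        fun y => f y • divTensor g C y + C y (grad g f y) :=
      funext fun y => divTensor_smul g (hpos.symm y) hC (hfd y)
    rw [heq]
    exact mdifferentiableAt_add_section ((hfd x).smul_section
      ((contMDiffAt_divTensor g hC hpos.symm).mdifferentiableAt (by simp))) hCf
  have hκ : MDiffAt (T% (fun y => f y • drift g C y)) x := (hfd x).smul_section
    ((smoothVField_drift h hC hpos).contMDiffAt.mdifferentiableAt (by simp))
  -- `div (f C) = C ∇f + f div C = Z - f κ`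
  have hsum : Z = fun y => divTensor g (fun y => f y • C y) y + f y • drift g C y := by
    funext y
    rw [divTensor_smul g (hpos.symm y) hC (hfd y)]
    simp only [Z, drift, smul_sub]
    abel
  rw [laplacian, hgrad, divergence_smul_sqrtDet h hZ, inv_mul_cancel_left₀ (hρ0 x), divDiv, hsum,
    divergence_add g hdiv hκ]
  ring

end DriftField

end RiemannianOps

open RiemannianOps in
theorem mainTheorem8 (d : ℕ) {M : Type*} [TopologicalSpace M] [T2Space M] [SigmaCompactSpace M]
    [ChartedSpace (EuclideanSpace ℝ (Fin d)) M] [IsManifold (𝓡 d) ∞ M]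
    (g : Metric (𝓡 d) M) (C : Tensor11 (𝓡 d) M)
    (hC : SmoothTensor11 C) (hpos : IsSymmPosDef g C) :
    ∃ g' : Metric (𝓡 d) M, IsChangeOfMetric g C g' ∧
      (∀ (x : M) (e : Module.Basis (Fin d) ℝ (TangentSpace (𝓡 d) x)),
        Real.sqrt (metricDet g x e / metricDet g' x e) = sqrtDet C x) ∧
      ∃ κ : VField (𝓡 d) M, SmoothVField κ ∧
        ∀ f : M → ℝ, ContMDiff (𝓡 d) 𝓘(ℝ, ℝ) ∞ f → ∀ x : M,
          (∀ e : Module.Basis (Fin d) ℝ (TangentSpace (𝓡 d) x), IsOrthonormal g x e →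
            ∑ i, ∑ j, components g C x e i j * hessian g f x (e i) (e j) =
              laplacian g' f x + g.inner x (κ x) (grad g f x)) ∧
          divDiv g (fun y => f y • C y) x =
            (sqrtDet C x)⁻¹ * laplacian g' (fun y => sqrtDet C y * f y) x
              - divergence g (fun y => f y • κ y) x := by
  have h := changedMetric_inner_apply hC hpos
  refine ⟨changedMetric hC hpos, isChangeOfMetric_changedMetric hC hpos,
    fun x e => sqrtDet_eq_of_inner h e, drift g C, smoothVField_drift h hC hpos,
    fun f hf x => ⟨fun e he => ?_, divDiv_smul_eq h hC hpos hf x⟩⟩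
  rw [sum_components_mul_hessian g (hpos.symm x) e he]
  exact trace_hessian_eq h hC hpos hf.contMDiffAt
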